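/- **Setting.** Let $d\ge 1$, and let $L(\mathbb T^d)$ be the set of complex functions on $\mathbb R^d$ that are $2\pi$-periodic in each variable and summable on the cube of periods $[0,2\pi]^d$, functions that agree almost everywhere being identified. For $f\in L(\mathbb T^d)$ put $$\widehat f(\mathbf k)=(2\pi)^{-d}\int_{[0,2\pi]^d}f(\mathbf x)e^{-i(\mathbf k,\mathbf x)}\,d\mathbf x,\qquad \mathbf k\in\mathbb Z^d,$$ $$\|f\|_{\mathcal S^p}=\Big(\sum_{\mathbf k\in\mathbb Z^d}|\widehat f(\mathbf k)|^p\Big)^{1/p},$$ and let $\mathcal S^p$ be the set of $f\in L(\mathbb T^d)$ with $\|f\|_{\mathcal S^p}<\infty$. Let $Y=\mathbb Z^d_+\cup\mathbb Z^d_-$, where $\mathbb Z^d_+$ and $\mathbb Z^d_-$ are the sets of vectors in $\mathbb Z^d$ all of whose coordinates are nonnegative, respectively all of whose coordinates are negative, and let $L_{1,Y}$ be the set of $f\in L(\mathbb T^d)$ with $\widehat f(\mathbf k)=0$ for all $\mathbf k\in\mathbb Z^d\setminus Y$. For $n\in\mathbb N=\{1,2,\dots\}$ let $$E_n^\Delta(f)_{\mathcal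 S^p}=\inf\|f-g\|_{\mathcal S^p},$$ the infimum being over all trigonometric polynomials $g(\mathbf x)=\sum_{|\mathbf k|_1\le n-1}a_{\mathbf k}e^{i(\mathbf k,\mathbf x)}$, $a_{\mathbf k}\in\mathbb C$, where $|\mathbf k|_1=\sum_{j}|k_j|$. For $\alpha>0$ and $t\ge 0$ let $$\omega_\alpha^\Delta(f,t)_{\mathcal S^p}=\sup_{h\in\mathbb R,\ |h|\le t}\Big\|\sum_{j=0}^\infty(-1)^j\binom{\alpha}{j}f(\cdot-jh)\Big\|_{\mathcal S^p},$$ where $\mathbf x-jh=(x_1-jh,\dots,x_d-jh)$. For $\tau>0$ let $M(\tau)$ be the set of bounded nondecreasing functions $\mu$ that are not constant on $[0,\tau]$, and for $1\le p<\infty$ put $$C_{n,\alpha,p}(\tau)=\left(\inf_{\mu\in M(\tau)}\frac{\mu(\tau)-\mu(0)}{2^{\alpha p/2}I_n(\tau,\mu)}\right)^{1/p},$$ $$I_n(\tau,\mu)=\inf_{\nu\in\mathbb N,\ \nu\ge n}\int_0^\tau\Big(1-\cos\frac{\nu t}{n}\Big)^{\alpha p/2}d\mu(t),$$ where the integral is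 a Stieltjes integral over $[0,\tau]$ and the quotient is $+\infty$ if $I_n(\tau,\mu)=0$; and $$K_{n,\alpha,p}(\tau)=\sup\left\{\frac{E_n^\Delta(f)_{\mathcal S^p}}{\omega_\alpha^\Delta(f,\tau/n)_{\mathcal S^p}}:\ f\in\mathcal S^p\cap L_{1,Y},\ f\ne\mathrm{const}\right\}.$$ **Theorem 3.1.** Let $1\le p<\infty$, $\tau>0$, $n\in\mathbb N$ and $\alpha>0$. Then $C_{n,\alpha,p}(\tau)<\infty$, and for every $f\in\mathcal S^p\cap L_{1,Y}$ $$E_n^\Delta(f)_{\mathcal S^p}\le C_{n,\alpha,p}(\tau)\,\omega_\alpha^\Delta\Big(f,\frac{\tau}{n}\Big)_{\mathcal S^p}.$$ Moreover, there is a function $\mu_*\in M(\tau)$ that attains the infimum in the definition of $C_{n,\alpha,p}(\tau)$, and the inequality is sharp in the sense that $$C_{n,\alpha,p}(\tau)=K_{n,\alpha,p}(\tau).$$ -/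

import Mathlib

open MeasureTheory Set
open scoped ENNReal

noncomputable section

namespace JacksonSp

instance fact_two_pi_pos : Fact (0 < 2 * Real.pi) := ⟨Real.two_pi_pos⟩

/-- The torus `ℝ^d / (2πℤ)^d`. Functions on it are the functions on `ℝ^d` that are `2π`-periodic in
each variable; its `volume` is Lebesgue measure on the cube of periods (total mass `(2π)^d`). -/
abbrev Torus (d : ℕ) : Type := Fin d → AddCircle (2 * Real.pi)

/-- The character `x ↦ e^{i(k,x)}`. -/
def expo {d : ℕ} (k : Fin d → ℤ) (x : Torus d) : ℂ := ∏ j, fourier (k j) (x j)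

theorem expo_coe {d : ℕ} (k : Fin d → ℤ) (y : Fin d → ℝ) :
    expo k (fun j => (y j : AddCircle (2 * Real.pi))) =
      Complex.exp (Complex.I * ∑ j, (k j : ℂ) * (y j : ℂ)) := by
  have hpi : (Real.pi : ℂ) ≠ 0 := by exact_mod_cast Real.pi_ne_zero
  unfold expo
  rw [Finset.mul_sum, Complex.exp_sum]
  refine Finset.prod_congr rfl fun j _ => ?_
  rw [fourier_coe_apply]
  congr 1
  push_cast
  field_simp

/-- The Fourier coefficient `(2π)^{-d} ∫ f(x) e^{-i(k,x)} dx`. -/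
def coeff {d : ℕ} (f : Torus d → ℂ) (k : Fin d → ℤ) : ℂ :=
  (((2 * Real.pi) ^ d)⁻¹ : ℝ) * ∫ x, f x * (starRingEnd ℂ) (expo k x)

/-- The norm `(∑_k |f̂(k)|^p)^{1/p}`, with value `∞` allowed. -/
def spNorm {d : ℕ} (p : ℝ) (f : Torus d → ℂ) : ℝ≥0∞ :=
  (∑' k : Fin d → ℤ, ENNReal.ofReal (‖coeff f k‖ ^ p)) ^ (1 / p)

/-- Membership in the space `S^p`: summable functions with finite norm. -/
def MemSp {d : ℕ} (p : ℝ) (f : Torus d → ℂ) : Prop :=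
  Integrable f ∧ spNorm p f < ∞

/-- `Y = ℤ_+^d ∪ ℤ_-^d`: all coordinates nonnegative, or all coordinates negative. -/
def specY (d : ℕ) : Set (Fin d → ℤ) := {k | ∀ j, 0 ≤ k j} ∪ {k | ∀ j, k j < 0}

/-- The Fourier coefficients of `f` vanish outside `Y`. -/
def HasSpecY {d : ℕ} (f : Torus d → ℂ) : Prop := ∀ k, k ∉ specY d → coeff f k = 0

/-- `|k|_1 = ∑_j |k_j|`. -/
def l1 {d : ℕ} (k : Fin d → ℤ) : ℕ := ∑ j, (k j).natAbs

/-- Triangular polynomials `∑_{|k|_1 ≤ m} a_k e^{i(k,x)}`. -/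
def triPoly (d m : ℕ) : Submodule ℂ (Torus d → ℂ) :=
  Submodule.span ℂ (expo '' {k : Fin d → ℤ | l1 k ≤ m})

/-- The best approximation of `f` of order `n - 1` by triangular polynomials (for `n ≥ 1`). -/
def bestApprox {d : ℕ} (p : ℝ) (n : ℕ) (f : Torus d → ℂ) : ℝ≥0∞ :=
  ⨅ g ∈ triPoly d (n - 1), spNorm p (f - g)

/-- The difference `∑_{j ≥ 0} (-1)^j (α choose j) f(x - jh)` of order `α`, where `x - jh` means that
the scalar `jh` is subtracted from every coordinate of `x`. For summable `f` and `α > 0` the series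
converges absolutely at almost every `x`. -/
def fracDiff {d : ℕ} (α h : ℝ) (f : Torus d → ℂ) (x : Torus d) : ℂ :=
  ∑' j : ℕ, (((-1) ^ j * Ring.choose α j : ℝ) : ℂ) *
    f (fun i => x i - ((j * h : ℝ) : AddCircle (2 * Real.pi)))

/-- The modulus of smoothness of order `α`. -/
def modulus {d : ℕ} (p α : ℝ) (f : Torus d → ℂ) (t : ℝ) : ℝ≥0∞ :=
  ⨆ h ∈ {h : ℝ | |h| ≤ t}, spNorm p (fracDiff α h f)

/-- The set of functions that are nondecreasing (hence bounded) and nonconstant on `[0, τ]`.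
Only the values on `[0, τ]` are ever used. -/
def admissible (τ : ℝ) : Set (ℝ → ℝ) :=
  {μ | MonotoneOn μ (Icc 0 τ) ∧ ¬ ∃ c, ∀ t ∈ Icc 0 τ, μ t = c}

/-- The extension of `μ` from `[0, τ]` by the constants `μ 0` and `μ τ`. -/
def clampExt (τ : ℝ) (μ : ℝ → ℝ) (t : ℝ) : ℝ := μ (max 0 (min τ t))

open Classical in
/-- The Lebesgue-Stieltjes measure `dμ` of `μ` on `[0, τ]`, including the jumps of `μ` at both end
points, so that its total mass is `μ τ - μ 0` (it is `0` if `μ` is not nondecreasing). -/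
def stieltjesMeasure (τ : ℝ) (μ : ℝ → ℝ) : Measure ℝ :=
  if h : Monotone (clampExt τ μ) then h.stieltjesFunction.measure else 0

/-- `I_n(τ, μ) = inf_{ν ≥ n} ∫_0^τ (1 - cos (νt/n))^{αp/2} dμ(t)`. -/
def infIntegral (n : ℕ) (α p τ : ℝ) (μ : ℝ → ℝ) : ℝ :=
  ⨅ ν : {ν : ℕ // n ≤ ν},
    ∫ t in Icc 0 τ, (1 - Real.cos ((ν : ℕ) / n * t)) ^ (α * p / 2) ∂(stieltjesMeasure τ μ)

/-- `(μ(τ) - μ(0)) / (2^{αp/2} I_n(τ, μ))`, which is `∞` if the denominator vanishes. -/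
def ratio (n : ℕ) (α p τ : ℝ) (μ : ℝ → ℝ) : ℝ≥0∞ :=
  ENNReal.ofReal (μ τ - μ 0) /
    ENNReal.ofReal ((2 : ℝ) ^ (α * p / 2) * infIntegral n α p τ μ)

/-- The constant `C_{n,α,p}(τ)`. -/
def constC (n : ℕ) (α p τ : ℝ) : ℝ≥0∞ :=
  (⨅ μ ∈ admissible τ, ratio n α p τ μ) ^ (1 / p)

/-- The exact Jackson constant `K_{n,α,p}(τ)`: the supremum of `E_n(f) / ω_α(f, τ/n)` over the
nonconstant functions of `S^p` with spectrum in `Y`. -/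
def constK (d n : ℕ) (α p τ : ℝ) : ℝ≥0∞ :=
  ⨆ f ∈ {f : Torus d → ℂ | MemSp p f ∧ HasSpecY f ∧ ¬ ∃ c : ℂ, f =ᵐ[volume] fun _ => c},
    bestApprox p n f / modulus p α f (τ / n)

end JacksonSp

end

/-!
On the spectrum `Y` the translation by `h` in all coordinates multiplies the `k`-th coefficient by
`e^{∓i|k|_1 h}`, so the `p`-th power of the norm of the difference of order `α` is
`∑_k (2 (1 - cos (|k|_1 h)))^{αp/2} |f̂(k)|^p`, while `E_n(f)^p` is the sum of `|f̂(k)|^p` over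
`|k|_1 ≥ n`. Both depend on `f` only through the mass that `|f̂|^p` gives to each `ν = |k|_1`.

This is a zero-sum game: one player picks `ν ≥ n`, the other picks `t ∈ [0, τ]`, and the payoff is
`(2 (1 - cos (νt/n)))^{αp/2}`. A normalized `μ ∈ M(τ)` is a mixed strategy for `t`, and a finite
mixture of the `ν` is a polynomial in one variable whose coefficients have the prescribed `p`-th
powers. Since `[0, τ]` is compact and the payoff is continuous, the separation theorem and the Riesz
representation theorem yield an optimal strategy `μ_*` and near-optimal mixtures of the `ν`. The
value `V` is positive because Lebesgue measure guarantees a positive payoff uniformly in `ν`. So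
`C = V^{-1/p}`: integrating the first formula against `μ_*` gives the inequality, and the
polynomials of the near-optimal mixtures show that it is sharp.
-/

noncomputable section

namespace JacksonSp

/-! ### The binomial series on the closed unit disc -/

theorem succ_mul_choose_succ (α : ℝ) (j : ℕ) :
    ((j : ℝ) + 1) * Ring.choose α (j + 1) = Ring.choose α j * (α - j) := by
  have h := Ring.choose_smul_choose α (Nat.le_succ j)
  simpa [Nat.succ_sub (le_refl j)] using h

theorem summable_abs_choose {α : ℝ} (hα : 0 < α) : Summable fun j : ℕ => |Ring.choose α j| := by
  obtain ⟨N, hN⟩ := exists_nat_gt α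
  rw [← summable_nat_add_iff N, ← summable_mul_left_iff hα.ne']
  -- Beyond `α`, the terms `α |choose α j|` telescope: they are `u j - u (j + 1)`.
  let u : ℕ → ℝ := fun j => ((j + N : ℕ) : ℝ) * |Ring.choose α (j + N)|
  have telescope (j : ℕ) : α * |Ring.choose α (j + N)| = u j - u (j + 1) := by
    have h := congrArg abs (succ_mul_choose_succ α (j + N))
    have hj : α - ((j + N : ℕ) : ℝ) < 0 := by
      push_cast
      linarith [(Nat.cast_nonneg j : (0 : ℝ) ≤ j)]
    rw [abs_mul, abs_mul, abs_of_neg hj, abs_of_nonneg (by positivity)] at h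
    simp only [u, show j + 1 + N = j + N + 1 by ring]
    push_cast at h ⊢
    linarith
  refine summable_of_sum_range_le (c := u 0) (fun j => by positivity) fun n => ?_
  simp_rw [telescope, Finset.sum_range_sub']
  have : 0 ≤ u n := by positivity
  linarith

theorem norm_tsum_choose_mul_pow_of_norm_lt_one (α : ℝ) {z : ℂ} (hz : ‖z‖ < 1) :
    ‖∑' j : ℕ, (((-1) ^ j * Ring.choose α j : ℝ) : ℂ) * z ^ j‖ = ‖1 - z‖ ^ α := by
  have h := (Complex.one_add_cpow_hasFPowerSeriesOnBall_zero (a := (α : ℂ))).hasSum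
    (y := -z) (by simpa [enorm_eq_nnnorm, ← NNReal.coe_lt_coe] using hz)
  rw [zero_add, ← sub_eq_add_neg] at h
  rw [← Complex.norm_cpow_real, ← h.tsum_eq]
  congr 1
  refine tsum_congr fun j => ?_
  simp only [binomialSeries_apply, List.ofFn_const, List.prod_replicate, ← Complex.ofReal_choose,
    smul_eq_mul, neg_pow z]
  push_cast
  ring

theorem norm_tsum_choose_mul_pow {α : ℝ} (hα : 0 < α) {z : ℂ} (hz : ‖z‖ ≤ 1) :
    ‖∑' j : ℕ, (((-1) ^ j * Ring.choose α j : ℝ) : ℂ) * z ^ j‖ = ‖1 - z‖ ^ α := by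
  have hseries : ContinuousOn
      (fun z : ℂ => ∑' j : ℕ, (((-1) ^ j * Ring.choose α j : ℝ) : ℂ) * z ^ j)
      (Metric.closedBall 0 1) := by
    refine continuousOn_tsum (fun j => by fun_prop) (summable_abs_choose hα) fun j w hw => ?_
    rw [norm_mul, Complex.norm_real, norm_pow, Real.norm_eq_abs, abs_mul, abs_pow, abs_neg, abs_one,
      one_pow, one_mul]
    exact mul_le_of_le_one_right (abs_nonneg _)
      (pow_le_one₀ (norm_nonneg _) (mem_closedBall_zero_iff.1 hw))
  have hpow : ContinuousOn (fun w : ℂ => ‖1 - w‖ ^ α) (Metric.closedBall 0 1) :=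
    (Continuous.rpow_const (by fun_prop) fun _ => Or.inr hα.le).continuousOn
  have hball : EqOn (fun z : ℂ => ‖∑' j : ℕ, (((-1) ^ j * Ring.choose α j : ℝ) : ℂ) * z ^ j‖)
      (fun w : ℂ => ‖1 - w‖ ^ α) (Metric.ball 0 1) := fun w hw =>
    norm_tsum_choose_mul_pow_of_norm_lt_one α (mem_ball_zero_iff.1 hw)
  exact hball.of_subset_closure hseries.norm hpow Metric.ball_subset_closedBall
    (closure_ball _ one_ne_zero).ge (mem_closedBall_zero_iff.2 hz)

/-! ### The symbol of a difference operator -/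

/-- The modulus `|1 - e^{is}| ^ γ` of the Fourier multiplier of the difference of order `γ`; here
`s` is the product of the step and the frequency. -/
def diffSymbol (γ s : ℝ) : ℝ := ‖1 - Complex.exp (s * Complex.I)‖ ^ γ

theorem diffSymbol_nonneg (γ s : ℝ) : 0 ≤ diffSymbol γ s := Real.rpow_nonneg (norm_nonneg _) _

theorem diffSymbol_rpow (γ p s : ℝ) : diffSymbol γ s ^ p = diffSymbol (γ * p) s :=
  (Real.rpow_mul (norm_nonneg _) _ _).symm

theorem continuous_diffSymbol {γ : ℝ} (hγ : 0 ≤ γ) : Continuous (diffSymbol γ) :=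
  Continuous.rpow_const (by fun_prop) fun _ => Or.inr hγ

theorem diffSymbol_eq (γ s : ℝ) : diffSymbol γ s = (2 * (1 - Real.cos s)) ^ (γ / 2) := by
  have hsq : ‖1 - Complex.exp (s * Complex.I)‖ ^ 2 = 2 * (1 - Real.cos s) := by
    rw [← Complex.normSq_eq_norm_sq, Complex.normSq_apply]
    simp only [Complex.sub_re, Complex.sub_im, Complex.one_re, Complex.one_im,
      Complex.exp_ofReal_mul_I_re, Complex.exp_ofReal_mul_I_im]
    linarith [Real.sin_sq_add_cos_sq s]
  rw [diffSymbol, ← hsq, ← Real.rpow_natCast_mul (norm_nonneg _)]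
  congr 1
  push_cast
  ring

theorem diffSymbol_abs (γ s : ℝ) : diffSymbol γ |s| = diffSymbol γ s := by
  rw [diffSymbol_eq, diffSymbol_eq, Real.cos_abs]

theorem exists_forall_sinc_le {a : ℝ} (ha : 0 < a) : ∃ ρ < 1, ∀ x, a ≤ x → Real.sinc x ≤ ρ := by
  obtain ⟨x₀, hx₀, hmax⟩ := (isCompact_Icc (a := a) (b := a + 2)).exists_isMaxOn
    (nonempty_Icc.2 (by linarith)) Real.continuous_sinc.continuousOn
  have hx₀pos : 0 < x₀ := ha.trans_le hx₀.1
  have hlt : Real.sinc x₀ < 1 := by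
    rw [Real.sinc_of_ne_zero hx₀pos.ne', div_lt_one hx₀pos]
    exact Real.sin_lt hx₀pos
  refine ⟨max (Real.sinc x₀) 2⁻¹, max_lt hlt (by norm_num), fun x hx => ?_⟩
  rcases le_total x (a + 2) with hxa | hxa
  · exact (hmax ⟨hx, hxa⟩).trans (le_max_left _ _)
  · calc Real.sinc x ≤ |x|⁻¹ := Real.sinc_le_inv_abs (by linarith)
      _ ≤ 2⁻¹ := inv_anti₀ two_pos ((by linarith : 2 ≤ x).trans (le_abs_self x))
      _ ≤ _ := le_max_right _ _

theorem setAverage_one_sub_cos_div_two {s τ : ℝ} (hs : 0 < s) (hτ : 0 < τ) :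
    ⨍ t in Icc 0 τ, (1 - Real.cos (s * t)) / 2 = (1 - Real.sinc (s * τ)) / 2 := by
  have hcos : ∫ t in (0)..τ, Real.cos (s * t) = Real.sin (s * τ) / s := by
    rw [intervalIntegral.integral_comp_mul_left _ hs.ne', integral_cos, mul_zero, Real.sin_zero,
      sub_zero, smul_eq_mul, inv_mul_eq_div]
  have hi : IntervalIntegrable (fun t => Real.cos (s * t)) volume 0 τ :=
    Continuous.intervalIntegrable (by fun_prop) _ _
  rw [setAverage_eq, integral_Icc_eq_integral_Ioc, ← intervalIntegral.integral_of_le hτ.le,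
    intervalIntegral.integral_div, intervalIntegral.integral_sub (by simp) hi, hcos,
    Real.sinc_of_ne_zero (mul_pos hs hτ).ne']
  simp only [Real.volume_real_Icc_of_le hτ.le, intervalIntegral.integral_const, smul_eq_mul,
    sub_zero]
  field_simp

theorem exists_forall_le_integral_diffSymbol {γ τ : ℝ} (hγ : 0 ≤ γ) (hτ : 0 < τ) :
    ∃ ε > 0, ∀ s : ℝ, 1 ≤ s → ε ≤ ∫ t in Icc 0 τ, diffSymbol γ (s * t) := by
  obtain ⟨ρ, hρ, hsinc⟩ := exists_forall_sinc_le hτ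
  set q : ℝ := max (γ / 2) 1
  have hq : 0 ≤ q := zero_le_one.trans (le_max_right _ _)
  have : 0 < (1 - ρ) / 2 := by linarith
  refine ⟨τ * ((1 - ρ) / 2) ^ q, by positivity, fun s hs => ?_⟩
  set y : ℝ → ℝ := fun t => (1 - Real.cos (s * t)) / 2 with hy
  have hy0 (t : ℝ) : 0 ≤ y t := by
    rw [hy]
    linarith [Real.cos_le_one (s * t)]
  have hy1 (t : ℝ) : y t ≤ 1 := by
    rw [hy]
    linarith [Real.neg_one_le_cos (s * t)]
  have hycont : Continuous y := by fun_prop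
  have hyq : Continuous fun t => y t ^ q := hycont.rpow_const fun _ => Or.inr hq
  have hsymbol (t : ℝ) : y t ^ q ≤ diffSymbol γ (s * t) := by
    rw [diffSymbol_eq, show 2 * (1 - Real.cos (s * t)) = 4 * y t by rw [hy]; ring]
    calc y t ^ q ≤ y t ^ (γ / 2) := Real.rpow_le_rpow_of_exponent_ge' (hy0 t) (hy1 t)
          (by positivity) (le_max_left _ _)
      _ ≤ (4 * y t) ^ (γ / 2) :=
          Real.rpow_le_rpow (hy0 t) (by linarith [hy0 t]) (by positivity)
  have jensen : (⨍ t in Icc 0 τ, y t) ^ q ≤ ⨍ t in Icc 0 τ, y t ^ q :=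
    (convexOn_rpow (le_max_right _ _)).map_set_average_le
      (Real.continuous_rpow_const hq).continuousOn isClosed_Ici (by simpa using hτ) (by simp)
      (.of_forall hy0) hycont.integrableOn_Icc hyq.integrableOn_Icc
  calc τ * ((1 - ρ) / 2) ^ q ≤ τ * (⨍ t in Icc 0 τ, y t) ^ q := by
        rw [setAverage_one_sub_cos_div_two (by linarith) hτ]
        gcongr
        exact hsinc _ (le_mul_of_one_le_left hτ.le hs)
    _ ≤ τ * ⨍ t in Icc 0 τ, y t ^ q := by gcongr
    _ = ∫ t in Icc 0 τ, y t ^ q := by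
        rw [setAverage_eq, Real.volume_real_Icc_of_le hτ.le, sub_zero, smul_eq_mul,
          mul_inv_cancel_left₀ hτ.ne']
    _ ≤ ∫ t in Icc 0 τ, diffSymbol γ (s * t) :=
        integral_mono hyq.integrableOn_Icc
          ((continuous_diffSymbol hγ).comp (continuous_const_mul s)).integrableOn_Icc hsymbol

variable {d : ℕ}

/-! ### Fourier coefficients on the torus -/

theorem continuous_expo (k : Fin d → ℤ) : Continuous (expo k : Torus d → ℂ) := by
  unfold expo
  fun_prop

theorem norm_expo (k : Fin d → ℤ) (x : Torus d) : ‖expo k x‖ = 1 := by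
  rw [expo, norm_prod]
  exact Finset.prod_eq_one fun j _ => by rw [fourier_apply]; exact Circle.norm_coe _

theorem expo_add (k : Fin d → ℤ) (x y : Torus d) : expo k (x + y) = expo k x * expo k y := by
  simp only [expo, Pi.add_apply, ← Finset.prod_mul_distrib, fourier_apply, smul_add,
    AddCircle.toCircle_add, Circle.coe_mul]

theorem integrable_expo (k : Fin d → ℤ) : Integrable (expo k : Torus d → ℂ) :=
  Integrable.of_bound (continuous_expo k).aestronglyMeasurable 1
    (.of_forall fun x => (norm_expo k x).le)

theorem integrable_mul_conj_expo {f : Torus d → ℂ} (hf : Integrable f) (k : Fin d → ℤ) :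
    Integrable fun x => f x * (starRingEnd ℂ) (expo k x) :=
  hf.mul_bdd (c := 1) (Complex.continuous_conj.comp (continuous_expo k)).aestronglyMeasurable
    (.of_forall fun x => by rw [RCLike.norm_conj, norm_expo])

theorem integral_fourier_mul_conj_fourier {T : ℝ} [hT : Fact (0 < T)] (a b : ℤ) :
    ∫ x : AddCircle T, fourier a x * (starRingEnd ℂ) (fourier b x) =
      if b = a then (T : ℂ) else 0 := by
  have h := congrFun (fourierCoeff_fourier (T := T) a) b
  rw [fourierCoeff, AddCircle.integral_haarAddCircle, Pi.single_apply,
    inv_smul_eq_iff₀ hT.out.ne'] at h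
  simp_rw [mul_comm (fourier a _), ← fourier_neg, ← smul_eq_mul, h]
  split_ifs <;> simp

theorem coeff_expo (m k : Fin d → ℤ) : coeff (expo m) k = if k = m then 1 else 0 := by
  unfold coeff expo
  simp_rw [map_prod, ← Finset.prod_mul_distrib]
  rw [integral_fintype_prod_volume_eq_prod fun (j : Fin d) (x : AddCircle (2 * Real.pi)) =>
    fourier (m j) x * (starRingEnd ℂ) (fourier (k j) x)]
  simp_rw [integral_fourier_mul_conj_fourier]
  split_ifs with hkm
  · subst hkm
    simp only [if_true, Finset.prod_const, Finset.card_univ, Fintype.card_fin]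
    rw [← Complex.ofReal_pow, ← Complex.ofReal_mul, inv_mul_cancel₀ (by positivity),
      Complex.ofReal_one]
  · obtain ⟨j, hj⟩ := Function.ne_iff.1 hkm
    rw [Finset.prod_eq_zero (Finset.mem_univ j) (if_neg hj), mul_zero]

theorem coeff_congr_ae {f g : Torus d → ℂ} (h : f =ᵐ[volume] g) : coeff f = coeff g := by
  ext k
  exact congrArg _ (integral_congr_ae (h.mul .rfl))

theorem coeff_smul (c : ℂ) (f : Torus d → ℂ) (k : Fin d → ℤ) :
    coeff (c • f) k = c * coeff f k := by
  simp only [coeff, Pi.smul_apply, smul_eq_mul, mul_assoc]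
  rw [integral_const_mul, mul_left_comm]

theorem coeff_sub {f g : Torus d → ℂ} (hf : Integrable f) (hg : Integrable g) (k : Fin d → ℤ) :
    coeff (f - g) k = coeff f k - coeff g k := by
  simp only [coeff, Pi.sub_apply, sub_mul]
  rw [integral_sub (integrable_mul_conj_expo hf k) (integrable_mul_conj_expo hg k), mul_sub]

theorem coeff_sum {ι : Type*} {s : Finset ι} {F : ι → Torus d → ℂ}
    (hF : ∀ i ∈ s, Integrable (F i)) (k : Fin d → ℤ) :
    coeff (∑ i ∈ s, F i) k = ∑ i ∈ s, coeff (F i) k := by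
  simp only [coeff, Finset.sum_apply, Finset.sum_mul]
  rw [integral_finsetSum _ fun i hi => integrable_mul_conj_expo (hF i hi) k, Finset.mul_sum]

theorem coeff_tsum {ι : Type*} [Countable ι] {F : ι → Torus d → ℂ} (hF : ∀ i, Integrable (F i))
    (hsum : Summable fun i => ∫ x, ‖F i x‖) (k : Fin d → ℤ) :
    coeff (fun x => ∑' i, F i x) k = ∑' i, coeff (F i) k := by
  simp only [coeff, ← tsum_mul_right, tsum_mul_left]
  rw [integral_tsum_of_summable_integral_norm fun i => integrable_mul_conj_expo (hF i) k]
  simpa only [norm_mul, RCLike.norm_conj, norm_expo, mul_one] using hsum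

theorem integrable_sum_smul_expo {ι : Type*} (s : Finset ι) (c : ι → ℂ) (κ : ι → Fin d → ℤ) :
    Integrable (∑ i ∈ s, c i • expo (κ i) : Torus d → ℂ) :=
  integrable_finsetSum' _ fun i _ => (integrable_expo (κ i)).smul (c i)

theorem coeff_sum_smul_expo {ι : Type*} (s : Finset ι) (c : ι → ℂ) (κ : ι → Fin d → ℤ)
    (k : Fin d → ℤ) :
    coeff (∑ i ∈ s, c i • expo (κ i)) k = ∑ i ∈ s, if k = κ i then c i else 0 := by
  rw [coeff_sum fun i _ => (integrable_expo (κ i)).smul (c i)]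
  simp_rw [coeff_smul, coeff_expo, mul_ite, mul_one, mul_zero]

theorem coeff_translate (f : Torus d → ℂ) (c : Torus d) (k : Fin d → ℤ) :
    coeff (fun x => f (x - c)) k = (starRingEnd ℂ) (expo k c) * coeff f k := by
  have h := integral_sub_right_eq_self (μ := (volume : Measure (Torus d)))
    (fun x => f x * (starRingEnd ℂ) (expo k (x + c))) c
  simp only [sub_add_cancel, expo_add, map_mul, ← mul_assoc, integral_mul_const] at h
  rw [coeff, h, coeff]
  ring

theorem conj_expo_diag (k : Fin d → ℤ) (h : ℝ) (j : ℕ) :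
    (starRingEnd ℂ) (expo k fun _ => ((j * h : ℝ) : AddCircle (2 * Real.pi))) =
      Complex.exp ((-(h * (∑ i, k i : ℤ)) : ℝ) * Complex.I) ^ j := by
  rw [expo_coe k fun _ => (j * h : ℝ), ← Complex.exp_conj, ← Complex.exp_nat_mul,
    ← Finset.sum_mul]
  congr 1
  simp only [map_mul, map_sum, map_intCast, Complex.conj_I, Complex.conj_ofReal]
  push_cast
  ring

theorem coeff_fracDiff {α : ℝ} (hα : 0 < α) (h : ℝ) {f : Torus d → ℂ} (hf : Integrable f)
    (k : Fin d → ℤ) :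
    coeff (fracDiff α h f) k =
      (∑' j : ℕ, (((-1) ^ j * Ring.choose α j : ℝ) : ℂ) *
        Complex.exp ((-(h * (∑ i, k i : ℤ)) : ℝ) * Complex.I) ^ j) * coeff f k := by
  let c : ℕ → Torus d := fun j _ => ((j * h : ℝ) : AddCircle (2 * Real.pi))
  let F : ℕ → Torus d → ℂ := fun j =>
    (((-1) ^ j * Ring.choose α j : ℝ) : ℂ) • fun x => f (x - c j)
  have hF (j : ℕ) : Integrable (F j) := (hf.comp_sub_right (c j)).smul _
  have hnorm (j : ℕ) : ∫ x, ‖F j x‖ = |Ring.choose α j| * ∫ x, ‖f x‖ := by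
    simp only [F, Pi.smul_apply, smul_eq_mul, norm_mul, Complex.norm_real, Real.norm_eq_abs,
      abs_pow, abs_neg, abs_one, one_pow, one_mul]
    rw [integral_const_mul, integral_sub_right_eq_self fun x => ‖f x‖]
  have hsum : Summable fun j => ∫ x, ‖F j x‖ := by
    simp_rw [hnorm]
    exact (summable_abs_choose hα).mul_right _
  calc coeff (fracDiff α h f) k = ∑' j, coeff (F j) k := coeff_tsum hF hsum k
    _ = _ := by
      rw [← tsum_mul_right]
      exact tsum_congr fun j => by rw [coeff_smul, coeff_translate, conj_expo_diag, mul_assoc]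

theorem norm_coeff_fracDiff {α : ℝ} (hα : 0 < α) (h : ℝ) {f : Torus d → ℂ} (hf : Integrable f)
    (k : Fin d → ℤ) :
    ‖coeff (fracDiff α h f) k‖ = diffSymbol α (h * (∑ i, k i : ℤ)) * ‖coeff f k‖ := by
  rw [coeff_fracDiff hα h hf, norm_mul,
    norm_tsum_choose_mul_pow hα (Complex.norm_exp_ofReal_mul_I _).le, ← diffSymbol,
    ← diffSymbol_abs, abs_neg, diffSymbol_abs]

/-! ### Norms and best approximations in terms of the coefficients -/

theorem spNorm_rpow {p : ℝ} (hp : 0 < p) (f : Torus d → ℂ) :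
    spNorm p f ^ p = ∑' k : Fin d → ℤ, ENNReal.ofReal (‖coeff f k‖ ^ p) := by
  rw [spNorm, one_div, ENNReal.rpow_inv_rpow hp.ne']

theorem abs_sum_eq_l1 {k : Fin d → ℤ} (hk : k ∈ specY d) : |∑ i, k i| = (l1 k : ℤ) := by
  rw [l1, Nat.cast_sum]
  simp_rw [Int.natCast_natAbs]
  rcases hk with hk | hk
  · rw [Finset.abs_sum_of_nonneg' hk]
    exact Finset.sum_congr rfl fun i _ => (abs_of_nonneg (hk i)).symm
  · rw [abs_of_nonpos (Finset.sum_nonpos fun i _ => (hk i).le), ← Finset.sum_neg_distrib]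
    exact Finset.sum_congr rfl fun i _ => (abs_of_neg (hk i)).symm

theorem spNorm_fracDiff_rpow {p α : ℝ} (hp : 0 < p) (hα : 0 < α) (h : ℝ) {f : Torus d → ℂ}
    (hf : Integrable f) (hY : HasSpecY f) :
    spNorm p (fracDiff α h f) ^ p = ∑' k : Fin d → ℤ,
      ENNReal.ofReal (diffSymbol (α * p) (l1 k * h)) * ENNReal.ofReal (‖coeff f k‖ ^ p) := by
  rw [spNorm_rpow hp]
  refine tsum_congr fun k => ?_
  by_cases hk : k ∈ specY d
  · have hsum : |((∑ i, k i : ℤ) : ℝ)| = l1 k := by exact_mod_cast abs_sum_eq_l1 hk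
    rw [norm_coeff_fracDiff hα h hf, Real.mul_rpow (diffSymbol_nonneg _ _) (norm_nonneg _),
      diffSymbol_rpow, ENNReal.ofReal_mul (diffSymbol_nonneg _ _), ← diffSymbol_abs, abs_mul, hsum,
      ← Nat.abs_cast (l1 k), ← abs_mul, diffSymbol_abs, mul_comm h, Nat.abs_cast]
  · rw [norm_coeff_fracDiff hα h hf, hY k hk, norm_zero, mul_zero, Real.zero_rpow hp.ne',
      ENNReal.ofReal_zero, mul_zero]

theorem spNorm_fracDiff_le_modulus {p α t h : ℝ} (f : Torus d → ℂ) (hh : |h| ≤ t) :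
    spNorm p (fracDiff α h f) ≤ modulus p α f t :=
  le_iSup₂ (f := fun h (_ : h ∈ {h : ℝ | |h| ≤ t}) => spNorm p (fracDiff α h f)) h hh

theorem finite_setOf_l1_le (m : ℕ) : {k : Fin d → ℤ | l1 k ≤ m}.Finite := by
  refine (finite_Icc (fun _ : Fin d => -(m : ℤ)) fun _ => (m : ℤ)).subset fun k hk => ?_
  have h (i : Fin d) : |k i| ≤ m := by
    rw [Int.abs_eq_natAbs]
    exact_mod_cast (Finset.single_le_sum (f := fun i => (k i).natAbs)
      (fun _ _ => Nat.zero_le _) (Finset.mem_univ i)).trans hk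
  exact ⟨fun i => (abs_le.1 (h i)).1, fun i => (abs_le.1 (h i)).2⟩

theorem exists_eq_sum_of_mem_triPoly {m : ℕ} {g : Torus d → ℂ} (hg : g ∈ triPoly d m) :
    ∃ (s : Finset (Fin d → ℤ)) (c : (Fin d → ℤ) → ℂ),
      (∀ k ∈ s, l1 k ≤ m) ∧ g = ∑ k ∈ s, c k • expo k := by
  obtain ⟨c, hc, rfl⟩ := (Finsupp.mem_span_image_iff_linearCombination ℂ).1 hg
  exact ⟨c.support, c, fun k hk => hc hk, rfl⟩

theorem integrable_of_mem_triPoly {m : ℕ} {g : Torus d → ℂ} (hg : g ∈ triPoly d m) :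
    Integrable g := by
  obtain ⟨s, c, -, rfl⟩ := exists_eq_sum_of_mem_triPoly hg
  exact integrable_sum_smul_expo s c fun k => k

theorem coeff_eq_zero_of_mem_triPoly {m : ℕ} {g : Torus d → ℂ} (hg : g ∈ triPoly d m)
    {k : Fin d → ℤ} (hk : m < l1 k) : coeff g k = 0 := by
  obtain ⟨s, c, hs, rfl⟩ := exists_eq_sum_of_mem_triPoly hg
  rw [coeff_sum_smul_expo s c fun k => k]
  refine Finset.sum_eq_zero fun j hj => if_neg ?_
  rintro rfl
  exact (hs k hj).not_gt hk

theorem exists_mem_triPoly_coeff_eq (m : ℕ) (f : Torus d → ℂ) :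
    ∃ g ∈ triPoly d m, ∀ k, l1 k ≤ m → coeff g k = coeff f k := by
  let s := (finite_setOf_l1_le (d := d) m).toFinset
  have hs (k : Fin d → ℤ) : k ∈ s ↔ l1 k ≤ m := Finite.mem_toFinset _
  refine ⟨∑ j ∈ s, coeff f j • expo j, Submodule.sum_mem _ fun j hj =>
    Submodule.smul_mem _ _ (Submodule.subset_span ⟨j, (hs j).1 hj, rfl⟩), fun k hk => ?_⟩
  rw [coeff_sum_smul_expo s (coeff f) fun k => k, Finset.sum_ite_eq, if_pos ((hs k).2 hk)]

theorem bestApprox_rpow {p : ℝ} (hp : 0 < p) {n : ℕ} (hn : 1 ≤ n) {f : Torus d → ℂ}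
    (hf : Integrable f) :
    bestApprox p n f ^ p = ∑' k : Fin d → ℤ,
      if n ≤ l1 k then ENNReal.ofReal (‖coeff f k‖ ^ p) else 0 := by
  apply le_antisymm
  · obtain ⟨g, hg, hgf⟩ := exists_mem_triPoly_coeff_eq (n - 1) f
    calc bestApprox p n f ^ p ≤ spNorm p (f - g) ^ p :=
          ENNReal.rpow_le_rpow (iInf₂_le _ hg) hp.le
      _ = _ := by
          rw [spNorm_rpow hp]
          refine tsum_congr fun k => ?_
          rw [coeff_sub hf (integrable_of_mem_triPoly hg)]
          split_ifs with hk
          · rw [coeff_eq_zero_of_mem_triPoly hg (by omega), sub_zero]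
          · rw [hgf k (by omega), sub_self, norm_zero, Real.zero_rpow hp.ne', ENNReal.ofReal_zero]
  · rw [← ENNReal.rpow_inv_le_iff hp, bestApprox]
    refine le_iInf₂ fun g hg => ?_
    rw [ENNReal.rpow_inv_le_iff hp, spNorm_rpow hp]
    refine ENNReal.tsum_le_tsum fun k => ?_
    split_ifs with hk
    · rw [coeff_sub hf (integrable_of_mem_triPoly hg),
        coeff_eq_zero_of_mem_triPoly hg (by omega), sub_zero]
    · exact zero_le

theorem bestApprox_eq_spNorm {p : ℝ} (hp : 0 < p) {n : ℕ} (hn : 1 ≤ n) {f : Torus d → ℂ}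
    (hf : Integrable f) (h : ∀ k, l1 k < n → coeff f k = 0) : bestApprox p n f = spNorm p f := by
  refine ENNReal.rpow_left_injective hp.ne' ?_
  simp only [bestApprox_rpow hp hn hf, spNorm_rpow hp]
  refine tsum_congr fun k => ite_eq_left_iff.2 fun hk => ?_
  rw [h k (not_le.1 hk), norm_zero, Real.zero_rpow hp.ne', ENNReal.ofReal_zero]

theorem bestApprox_eq_zero_of_ae_eq_const {p : ℝ} (hp : 0 < p) (n : ℕ) {f : Torus d → ℂ} {c : ℂ}
    (h : f =ᵐ[volume] fun _ => c) : bestApprox p n f = 0 := by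
  have hmem : c • expo 0 ∈ triPoly d (n - 1) :=
    Submodule.smul_mem _ _ (Submodule.subset_span ⟨0, by simp [l1], rfl⟩)
  have hzero : f - c • expo 0 =ᵐ[volume] 0 := by
    filter_upwards [h] with x hx
    simp [hx, expo]
  have hcoeff : coeff (f - c • expo 0) = 0 := by
    rw [coeff_congr_ae hzero]
    ext k
    simp [coeff]
  refine le_antisymm ((iInf₂_le _ hmem).trans_eq ?_) zero_le
  simp [spNorm, hcoeff, Real.zero_rpow hp.ne', hp]

/-! ### Games with a compact space of pure strategies -/

section Game

variable {K : Type*} [TopologicalSpace K]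

theorem map_nonneg_of_forall_map_lt {F : C(K, ℝ) →L[ℝ] ℝ} {c u : ℝ}
    (hF : ∀ g : C(K, ℝ), (∀ t, g t < c) → F g < u) {g : C(K, ℝ)} (hg : 0 ≤ g) : 0 ≤ F g := by
  by_contra! hneg
  obtain ⟨N, hN⟩ := exists_nat_gt ((u - (c - 1) * F 1) / (-F g))
  have hlt := hF ((c - 1) • 1 - (N : ℝ) • g) fun t => by
    have : 0 ≤ (N : ℝ) * g t := mul_nonneg N.cast_nonneg (hg t)
    simp only [ContinuousMap.sub_apply, ContinuousMap.smul_apply, ContinuousMap.one_apply,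
      smul_eq_mul]
    linarith
  rw [map_sub, map_smul, map_smul, smul_eq_mul, smul_eq_mul] at hlt
  rw [div_lt_iff₀ (by linarith)] at hN
  linarith

variable [CompactSpace K]

theorem exists_isProbabilityMeasure_integral_eq [T2Space K] [MeasurableSpace K] [BorelSpace K]
    (F : C(K, ℝ) →ₗ[ℝ] ℝ) (hF : ∀ g : C(K, ℝ), 0 ≤ g → 0 ≤ F g) (h1 : F 1 = 1) :
    ∃ m : Measure K, IsProbabilityMeasure m ∧ ∀ g : C(K, ℝ), ∫ t, g t ∂m = F g := by
  let toContinuousMap : CompactlySupportedContinuousMap K ℝ →ₗ[ℝ] C(K, ℝ) :=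
    { toFun g := g.toContinuousMap
      map_add' _ _ := rfl
      map_smul' _ _ := rfl }
  let Λ := PositiveLinearMap.mk₀ (F ∘ₗ toContinuousMap) fun g hg => hF _ hg
  have hΛ (g : C(K, ℝ)) : ∫ t, g t ∂(RealRMK.rieszMeasure Λ) = F g :=
    RealRMK.integral_rieszMeasure Λ (CompactlySupportedContinuousMap.continuousMapEquiv g)
  refine ⟨RealRMK.rieszMeasure Λ, ⟨?_⟩, hΛ⟩
  have hmass := hΛ 1
  simpa only [ContinuousMap.one_apply, integral_const, smul_eq_mul, mul_one, h1, measureReal_def,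
    ENNReal.toReal_eq_one_iff] using hmass

theorem exists_isProbabilityMeasure_forall_le_integral [T2Space K] [MeasurableSpace K]
    [BorelSpace K] {A : Set C(K, ℝ)} (hA : Convex ℝ A) (hne : A.Nonempty) {c : ℝ}
    (h : ∀ g ∈ A, ∃ t, c ≤ g t) :
    ∃ m : Measure K, IsProbabilityMeasure m ∧ ∀ g ∈ A, c ≤ ∫ t, g t ∂m := by
  have hconv : Convex ℝ {g : C(K, ℝ) | ∀ t, g t < c} := fun f hf g hg a b ha hb hab t =>
    convex_Iio c (hf t) (hg t) ha hb hab
  have hopen : IsOpen {g : C(K, ℝ) | ∀ t, g t < c} := by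
    simpa [MapsTo] using
      ContinuousMap.isOpen_setOfPred_mapsTo (X := K) isCompact_univ (isOpen_Iio (a := c))
  have hdisj : Disjoint {g : C(K, ℝ) | ∀ t, g t < c} A := by
    refine Set.disjoint_left.2 fun g hg hgA => ?_
    obtain ⟨t, ht⟩ := h g hgA
    exact (hg t).not_ge ht
  obtain ⟨F, u, hFc, hFA⟩ := geometric_hahn_banach_open hconv hopen hA hdisj
  have hF1 : 0 < F 1 := by
    obtain ⟨a, ha⟩ := hne
    have hlt := hFc (a - (‖a‖ + |c| + 1) • 1) fun t => by
      simp only [ContinuousMap.sub_apply, ContinuousMap.smul_apply, ContinuousMap.one_apply,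
        smul_eq_mul]
      linarith [(le_abs_self _).trans (a.norm_coe_le_norm t), neg_abs_le c]
    rw [map_sub, map_smul, smul_eq_mul] at hlt
    exact pos_of_mul_pos_right (by linarith [hFA a ha]) (by positivity : 0 ≤ ‖a‖ + |c| + 1)
  have hu : c * F 1 ≤ u := by
    refine le_of_forall_pos_lt_add fun ε hε => ?_
    have hlt := hFc ((c - ε / F 1) • 1) fun t => by simpa using div_pos hε hF1
    rw [map_smul, smul_eq_mul, sub_mul, div_mul_cancel₀ _ hF1.ne'] at hlt
    linarith
  obtain ⟨m, hm, hmF⟩ := exists_isProbabilityMeasure_integral_eq ((F 1)⁻¹ • F.toLinearMap)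
    (fun g hg => mul_nonneg (inv_nonneg.2 hF1.le) (map_nonneg_of_forall_map_lt hFc hg))
    (inv_mul_cancel₀ hF1.ne')
  refine ⟨m, hm, fun g hg => ?_⟩
  calc c ≤ F g / F 1 := (le_div_iff₀ hF1).2 (hu.trans (hFA g hg))
    _ = ∫ t, g t ∂m := by rw [hmF, div_eq_inv_mul]; rfl

/-- The upper value of the game in which one player chooses `i : ι`, the other one chooses `t : K`,
and the first pays `φ i t` to the second; the first may play finite mixtures of the `φ i`. -/
def gameValue {ι : Type*} (φ : ι → C(K, ℝ)) : ℝ :=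
  ⨅ g : convexHull ℝ (range φ), ⨆ t, (g : C(K, ℝ)) t

variable {ι : Type*} {φ : ι → C(K, ℝ)}

theorem exists_sum_mul_le_of_gameValue_lt [Nonempty ι] {b : ℝ} (hb : gameValue φ < b) :
    ∃ (s : Finset ι) (w : ι → ℝ), (∀ i ∈ s, 0 ≤ w i) ∧ ∑ i ∈ s, w i = 1 ∧
      ∀ t, ∑ i ∈ s, w i * φ i t ≤ b := by
  have : Nonempty (convexHull ℝ (range φ)) := (range_nonempty φ).convexHull.to_subtype
  obtain ⟨⟨g, hg⟩, hgb⟩ := exists_lt_of_ciInf_lt hb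
  rw [convexHull_range_eq_exists_affineCombination] at hg
  obtain ⟨s, w, hw, hw1, rfl⟩ := hg
  refine ⟨s, w, hw, hw1, fun t => ?_⟩
  have hle := (le_ciSup (isCompact_range (map_continuous _)).bddAbove t).trans hgb.le
  simpa [Finset.affineCombination_eq_linear_combination s φ w hw1, ContinuousMap.sum_apply]
    using hle

theorem exists_isProbabilityMeasure_gameValue_le [T2Space K] [Nonempty K] [MeasurableSpace K]
    [BorelSpace K] [Nonempty ι] (hφ : ∀ i, 0 ≤ φ i) :
    ∃ m : Measure K, IsProbabilityMeasure m ∧ ∀ i, gameValue φ ≤ ∫ t, φ i t ∂m := by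
  have hnonneg : convexHull ℝ (range φ) ⊆ Ici 0 :=
    convexHull_min (range_subset_iff.2 hφ) (convex_Ici 0)
  have hbdd : BddBelow (range fun g : convexHull ℝ (range φ) => ⨆ t, (g : C(K, ℝ)) t) :=
    ⟨0, forall_mem_range.2 fun g => Real.iSup_nonneg (hnonneg g.2)⟩
  have hmax (g : C(K, ℝ)) (hg : g ∈ convexHull ℝ (range φ)) : ∃ t, gameValue φ ≤ g t := by
    obtain ⟨t, -, ht⟩ := isCompact_univ.exists_isMaxOn univ_nonempty g.continuous.continuousOn
    exact ⟨t, (ciInf_le hbdd ⟨g, hg⟩).trans (ciSup_le fun s => ht (mem_univ s))⟩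
  obtain ⟨m, hm, hmg⟩ := exists_isProbabilityMeasure_forall_le_integral
    (convex_convexHull ℝ (range φ)) (range_nonempty φ).convexHull hmax
  exact ⟨m, hm, fun i => hmg _ (subset_convexHull ℝ _ (mem_range_self i))⟩

theorem le_gameValue_mul [MeasurableSpace K] [BorelSpace K] [Nonempty ι] {m : Measure K}
    [IsFiniteMeasure m] {r : ℝ} (h : ∀ i, r ≤ ∫ t, φ i t ∂m) :
    r ≤ gameValue φ * m.real univ := by
  have hint (g : C(K, ℝ)) : Integrable g m :=
    g.continuous.integrable_of_hasCompactSupport (HasCompactSupport.of_compactSpace _)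
  have hlin : IsLinearMap ℝ fun g : C(K, ℝ) => ∫ t, g t ∂m :=
    ⟨fun f g => integral_add (hint f) (hint g), fun a g => integral_const_mul a g⟩
  have hhull : convexHull ℝ (range φ) ⊆ {g | r ≤ ∫ t, g t ∂m} :=
    convexHull_min (range_subset_iff.2 h) (convex_halfSpace_ge hlin r)
  have : Nonempty (convexHull ℝ (range φ)) := (range_nonempty φ).convexHull.to_subtype
  rw [gameValue, Real.iInf_mul_of_nonneg measureReal_nonneg]
  refine le_ciInf fun g => (hhull g.2).trans ?_
  calc ∫ t, (g : C(K, ℝ)) t ∂m ≤ ∫ _, ⨆ t, (g : C(K, ℝ)) t ∂m :=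
        integral_mono (hint _) (integrable_const _)
          (le_ciSup (isCompact_range (map_continuous _)).bddAbove)
    _ = (⨆ t, (g : C(K, ℝ)) t) * m.real univ := by
        rw [integral_const, smul_eq_mul, mul_comm]

end Game

/-! ### Lebesgue-Stieltjes measures on `[0, τ]` -/

section Stieltjes

variable {τ : ℝ} {μ : ℝ → ℝ}

theorem mem_admissible_iff (hτ : 0 ≤ τ) :
    μ ∈ admissible τ ↔ MonotoneOn μ (Icc 0 τ) ∧ μ 0 < μ τ := by
  have h0 : (0 : ℝ) ∈ Icc 0 τ := left_mem_Icc.2 hτ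
  have hτ' : τ ∈ Icc 0 τ := right_mem_Icc.2 hτ
  refine and_congr_right fun hμ => ⟨fun hne => ?_, ?_⟩
  · by_contra! hle
    exact hne ⟨μ 0, fun t ht => ((hμ ht hτ' ht.2).trans hle).antisymm (hμ h0 ht ht.1)⟩
  · rintro hlt ⟨c, hc⟩
    exact hlt.ne ((hc 0 h0).trans (hc τ hτ').symm)

theorem clampExt_of_nonpos {t : ℝ} (ht : t ≤ 0) : clampExt τ μ t = μ 0 := by
  rw [clampExt, max_eq_left ((min_le_right _ _).trans ht)]

theorem clampExt_of_mem_Icc {t : ℝ} (ht : t ∈ Icc 0 τ) : clampExt τ μ t = μ t := by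
  rw [clampExt, min_eq_right ht.2, max_eq_right ht.1]

theorem clampExt_of_le (hτ : 0 ≤ τ) {t : ℝ} (ht : τ ≤ t) : clampExt τ μ t = μ τ := by
  rw [clampExt, min_eq_left ht, max_eq_right hτ]

theorem monotone_clampExt (hτ : 0 ≤ τ) (hμ : MonotoneOn μ (Icc 0 τ)) :
    Monotone (clampExt τ μ) := fun _ _ hst =>
  hμ ⟨le_max_left _ _, max_le hτ (min_le_left _ _)⟩ ⟨le_max_left _ _, max_le hτ (min_le_left _ _)⟩
    (max_le_max le_rfl (min_le_min le_rfl hst))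

open Filter Topology in
theorem stieltjesFunction_eq_of_eventuallyEq_cofinite {f : ℝ → ℝ} (hf : Monotone f)
    {F : StieltjesFunction ℝ} (h : f =ᶠ[cofinite] F) : hf.stieltjesFunction = F := by
  ext x
  have hF : Tendsto F (𝓝[>] x) (𝓝 (F x)) := (F.right_continuous x).mono Ioi_subset_Ici_self
  have hcof : 𝓝[>] x ≤ cofinite := (nhdsGT_le_nhdsNE x).trans (nhdsNE_le_cofinite x)
  exact rightLim_eq_of_tendsto (hF.congr' (h.filter_mono hcof).symm)

open Filter Topology in
theorem stieltjesMeasure_Icc (hτ : 0 ≤ τ) (hμ : MonotoneOn μ (Icc 0 τ)) :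
    stieltjesMeasure τ μ (Icc 0 τ) = ENNReal.ofReal (μ τ - μ 0) := by
  have hm := monotone_clampExt hτ hμ
  have hright : hm.stieltjesFunction τ = μ τ := by
    refine rightLim_eq_of_tendsto (tendsto_nhds_of_eventually_eq ?_)
    filter_upwards [self_mem_nhdsWithin] with t ht using clampExt_of_le hτ (le_of_lt ht)
  have hneg (t : ℝ) (ht : t < 0) : hm.stieltjesFunction t = μ 0 := by
    refine rightLim_eq_of_tendsto (tendsto_nhds_of_eventually_eq ?_)
    filter_upwards [Ioo_mem_nhdsGT ht] with s hs using clampExt_of_nonpos hs.2.le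
  have hleft : Function.leftLim hm.stieltjesFunction 0 = μ 0 := by
    refine leftLim_eq_of_tendsto (tendsto_nhds_of_eventually_eq ?_)
    filter_upwards [self_mem_nhdsWithin] with t ht using hneg t ht
  rw [stieltjesMeasure, dif_pos hm, StieltjesFunction.measure_Icc, hright, hleft]

/-- The Lebesgue-Stieltjes measure of `μ`, as a measure on the compact space `[0, τ]`. -/
def stieltjesOn (τ : ℝ) (μ : ℝ → ℝ) : Measure (Icc 0 τ) :=
  (stieltjesMeasure τ μ).comap Subtype.val

theorem stieltjesOn_univ (hτ : 0 ≤ τ) (hμ : MonotoneOn μ (Icc 0 τ)) :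
    stieltjesOn τ μ univ = ENNReal.ofReal (μ τ - μ 0) := by
  rw [stieltjesOn, comap_subtype_coe_apply measurableSet_Icc, image_univ, Subtype.range_coe,
    stieltjesMeasure_Icc hτ hμ]

open ProbabilityTheory

variable (m : Measure (Icc 0 τ)) [IsProbabilityMeasure m]

theorem cdf_map_subtypeVal_of_neg {t : ℝ} (ht : t < 0) : cdf (m.map Subtype.val) t = 0 := by
  have := Measure.isProbabilityMeasure_map (μ := m) measurable_subtype_coe.aemeasurable
  have hempty : Subtype.val ⁻¹' Iic t = (∅ : Set (Icc 0 τ)) :=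
    eq_empty_of_forall_notMem fun x hx => (ht.trans_le x.2.1).not_ge hx
  rw [cdf_eq_real, map_measureReal_apply measurable_subtype_coe measurableSet_Iic, hempty,
    measureReal_empty]

theorem cdf_map_subtypeVal_of_le {t : ℝ} (ht : τ ≤ t) : cdf (m.map Subtype.val) t = 1 := by
  have := Measure.isProbabilityMeasure_map (μ := m) measurable_subtype_coe.aemeasurable
  have huniv : Subtype.val ⁻¹' Iic t = (univ : Set (Icc 0 τ)) :=
    eq_univ_of_forall fun x => x.2.2.trans ht
  rw [cdf_eq_real, map_measureReal_apply measurable_subtype_coe measurableSet_Iic, huniv,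
    probReal_univ]

theorem exists_mem_admissible_stieltjesOn_eq (hτ : 0 < τ) :
    ∃ μ ∈ admissible τ, μ τ - μ 0 = 1 ∧ stieltjesOn τ μ = m := by
  have := Measure.isProbabilityMeasure_map (μ := m) measurable_subtype_coe.aemeasurable
  set F := cdf (m.map Subtype.val)
  -- Setting the value at `0` to `0` makes a possible atom of `m` at `0` a jump inside `[0, τ]`.
  set μ : ℝ → ℝ := (Ioi 0).indicator F
  have hμ0 : μ 0 = 0 := indicator_of_notMem (lt_irrefl 0) _
  have hμpos {t : ℝ} (ht : 0 < t) : μ t = F t := indicator_of_mem (mem_Ioi.2 ht) _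
  have hμτ : μ τ = 1 := (hμpos hτ).trans (cdf_map_subtypeVal_of_le m le_rfl)
  have hmono : Monotone μ := fun s t hst => by
    rcases le_or_gt s 0 with hs | hs
    · rw [show μ s = 0 from indicator_of_notMem hs.not_gt _]
      exact indicator_nonneg (fun _ _ => cdf_nonneg _ _) _
    · rw [hμpos hs, hμpos (hs.trans_le hst)]
      exact F.mono hst
  have hext : ∀ t ≠ 0, clampExt τ μ t = F t := fun t ht => by
    rcases ht.lt_or_gt with ht | ht
    · rw [clampExt_of_nonpos ht.le, hμ0, cdf_map_subtypeVal_of_neg m ht]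
    · rcases le_total t τ with htτ | htτ
      · rw [clampExt_of_mem_Icc ⟨ht.le, htτ⟩, hμpos ht]
      · rw [clampExt_of_le hτ.le htτ, hμτ, cdf_map_subtypeVal_of_le m htτ]
  have hclamp := monotone_clampExt hτ.le (hmono.monotoneOn (Icc 0 τ))
  have hfun : hclamp.stieltjesFunction = F :=
    stieltjesFunction_eq_of_eventuallyEq_cofinite hclamp
      ((finite_singleton 0).eventually_cofinite_notMem.mono hext)
  refine ⟨μ, (mem_admissible_iff hτ.le).2 ⟨hmono.monotoneOn _, by simp [hμ0, hμτ]⟩,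
    by simp [hμ0, hμτ], ?_⟩
  rw [stieltjesOn, stieltjesMeasure, dif_pos hclamp, hfun, measure_cdf,
    (MeasurableEmbedding.subtype_coe measurableSet_Icc).comap_map]

end Stieltjes

/-! ### The Jackson game -/

section Jackson

variable {α γ p τ : ℝ} {n : ℕ} {μ : ℝ → ℝ}

instance : Nonempty {ν : ℕ // n ≤ ν} := ⟨⟨n, le_rfl⟩⟩

/-- The payoff `t ↦ (2 (1 - cos (ν t / n))) ^ (γ / 2)` on `[0, τ]`, where `ν ≥ n`. For `γ = αp` its
integral against `dμ` is `2 ^ (αp / 2)` times the integral in the definition of `I_n(τ, μ)`. -/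
def payoff (hγ : 0 ≤ γ) (n : ℕ) (τ : ℝ) (ν : {ν : ℕ // n ≤ ν}) : C(Icc 0 τ, ℝ) where
  toFun t := diffSymbol γ (ν / n * t)
  continuous_toFun := (continuous_diffSymbol hγ).comp (by fun_prop)

theorem payoff_nonneg (hγ : 0 ≤ γ) (ν : {ν : ℕ // n ≤ ν}) : 0 ≤ payoff hγ n τ ν :=
  fun _ => diffSymbol_nonneg _ _

theorem gameValue_payoff_pos (hγ : 0 ≤ γ) (hτ : 0 < τ) (hn : 1 ≤ n) :
    0 < gameValue (payoff hγ n τ) := by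
  obtain ⟨ε, hε, hle⟩ := exists_forall_le_integral_diffSymbol hγ hτ
  have hn0 : (0 : ℝ) < n := by exact_mod_cast hn
  have : IsFiniteMeasure ((volume : Measure ℝ).comap ((↑) : Icc 0 τ → ℝ)) := ⟨by
    rw [comap_subtype_coe_apply measurableSet_Icc, image_univ, Subtype.range_coe]
    exact measure_Icc_lt_top⟩
  have hlow (ν : {ν : ℕ // n ≤ ν}) :
      ε ≤ ∫ t, payoff hγ n τ ν t ∂(volume : Measure ℝ).comap ((↑) : Icc 0 τ → ℝ) := by
    have hν : (1 : ℝ) ≤ ν / n := (one_le_div hn0).2 (by exact_mod_cast ν.2)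
    exact (hle _ hν).trans_eq (integral_subtype_comap measurableSet_Icc _).symm
  exact pos_of_mul_pos_left (hε.trans_le (le_gameValue_mul hlow)) measureReal_nonneg

theorem two_rpow_mul_infIntegral (hγ : 0 ≤ α * p) :
    2 ^ (α * p / 2) * infIntegral n α p τ μ =
      ⨅ ν, ∫ t, payoff hγ n τ ν t ∂stieltjesOn τ μ := by
  rw [infIntegral, Real.mul_iInf_of_nonneg (by positivity)]
  congr 1 with ν
  rw [← integral_const_mul, ← integral_subtype_comap measurableSet_Icc]
  refine integral_congr_ae (.of_forall fun t => ?_)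
  change _ = diffSymbol _ _
  rw [diffSymbol_eq, Real.mul_rpow zero_le_two (sub_nonneg.2 (Real.cos_le_one _))]

theorem inv_gameValue_le_ratio (hγ : 0 ≤ α * p) (hτ : 0 ≤ τ) (hμ : μ ∈ admissible τ) :
    (ENNReal.ofReal (gameValue (payoff hγ n τ)))⁻¹ ≤ ratio n α p τ μ := by
  obtain ⟨hmono, hlt⟩ := (mem_admissible_iff hτ).1 hμ
  set M := μ τ - μ 0
  have hM : 0 < M := sub_pos.2 hlt
  have hmass := stieltjesOn_univ hτ hmono
  have : IsFiniteMeasure (stieltjesOn τ μ) := ⟨hmass ▸ ENNReal.ofReal_lt_top⟩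
  have hreal : (stieltjesOn τ μ).real univ = M := by
    rw [measureReal_def, hmass, ENNReal.toReal_ofReal hM.le]
  have hbdd : BddBelow (range fun ν => ∫ t, payoff hγ n τ ν t ∂stieltjesOn τ μ) :=
    ⟨0, forall_mem_range.2 fun ν => integral_nonneg (payoff_nonneg hγ ν)⟩
  have hle : 2 ^ (α * p / 2) * infIntegral n α p τ μ ≤ gameValue (payoff hγ n τ) * M := by
    rw [two_rpow_mul_infIntegral hγ, ← hreal]
    exact le_gameValue_mul (ciInf_le hbdd)
  calc (ENNReal.ofReal (gameValue (payoff hγ n τ)))⁻¹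
      = ENNReal.ofReal M / ENNReal.ofReal (gameValue (payoff hγ n τ) * M) := by
        rw [ENNReal.ofReal_mul' hM.le, ← one_div, ← ENNReal.mul_div_mul_right 1 _
          (ENNReal.ofReal_pos.2 hM).ne' ENNReal.ofReal_ne_top, one_mul]
    _ ≤ ratio n α p τ μ := by rw [ratio]; gcongr

theorem exists_mem_admissible_ratio_eq (hγ : 0 ≤ α * p) (hτ : 0 < τ) :
    ∃ μ ∈ admissible τ, ratio n α p τ μ = (ENNReal.ofReal (gameValue (payoff hγ n τ)))⁻¹ := by
  have : Nonempty (Icc 0 τ) := (nonempty_Icc.2 hτ.le).to_subtype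
  obtain ⟨m, _, hm⟩ := exists_isProbabilityMeasure_gameValue_le (payoff_nonneg (τ := τ) (n := n) hγ)
  obtain ⟨μ, hμ, hμ1, rfl⟩ := exists_mem_admissible_stieltjesOn_eq m hτ
  refine ⟨μ, hμ, le_antisymm ?_ (inv_gameValue_le_ratio hγ hτ.le hμ)⟩
  rw [ratio, hμ1, ENNReal.ofReal_one, one_div, two_rpow_mul_infIntegral hγ]
  exact ENNReal.inv_le_inv.2 (ENNReal.ofReal_le_ofReal (le_ciInf hm))

theorem iInf_ratio_eq (hγ : 0 ≤ α * p) (hτ : 0 < τ) :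
    ⨅ μ ∈ admissible τ, ratio n α p τ μ =
      (ENNReal.ofReal (gameValue (payoff hγ n τ)))⁻¹ := by
  obtain ⟨μ, hμ, hratio⟩ := exists_mem_admissible_ratio_eq (n := n) hγ hτ
  exact le_antisymm (hratio ▸ iInf₂_le μ hμ)
    (le_iInf₂ fun _ hμ => inv_gameValue_le_ratio hγ hτ.le hμ)

theorem constC_eq (hγ : 0 ≤ α * p) (hτ : 0 < τ) :
    constC n α p τ = (ENNReal.ofReal (gameValue (payoff hγ n τ)))⁻¹ ^ (1 / p) := by
  rw [constC, iInf_ratio_eq hγ hτ]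

theorem constC_ne_top (hp : 0 < p) (hα : 0 < α) (hτ : 0 < τ) (hn : 1 ≤ n) :
    constC n α p τ ≠ ∞ := by
  have hγ : 0 ≤ α * p := by positivity
  rw [constC_eq hγ hτ]
  exact ENNReal.rpow_ne_top_of_nonneg (by positivity)
    (ENNReal.inv_ne_top.2 (ENNReal.ofReal_pos.2 (gameValue_payoff_pos hγ hτ hn)).ne')

theorem mul_bestApprox_rpow_le (hp : 0 < p) (hα : 0 < α) (hn : 1 ≤ n) (m : Measure (Icc 0 τ))
    [IsProbabilityMeasure m] {r : ℝ}
    (hr : ∀ ν, r ≤ ∫ t, payoff (mul_pos hα hp).le n τ ν t ∂m) {f : Torus d → ℂ}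
    (hf : Integrable f) (hY : HasSpecY f) :
    ENNReal.ofReal r * bestApprox p n f ^ p ≤ modulus p α f (τ / n) ^ p := by
  set D : (Fin d → ℤ) → Icc 0 τ → ℝ := fun k t => diffSymbol (α * p) (l1 k / n * t)
  have hD (k : Fin d → ℤ) : Continuous (D k) :=
    (continuous_diffSymbol (mul_pos hα hp).le).comp (by fun_prop)
  have hint (k : Fin d → ℤ) : Integrable (D k) m :=
    (hD k).integrable_of_hasCompactSupport (HasCompactSupport.of_compactSpace _)
  have hcoeff (k : Fin d → ℤ) (hk : n ≤ l1 k) :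
      ENNReal.ofReal r ≤ ∫⁻ t, ENNReal.ofReal (D k t) ∂m := by
    rw [← ofReal_integral_eq_lintegral_ofReal (hint k) (.of_forall fun t => diffSymbol_nonneg _ _)]
    exact ENNReal.ofReal_le_ofReal (hr ⟨l1 k, hk⟩)
  have hmod (t : Icc 0 τ) : ∑' k, ENNReal.ofReal (D k t) * ENNReal.ofReal (‖coeff f k‖ ^ p) ≤
      modulus p α f (τ / n) ^ p := by
    have ht : |(t : ℝ) / n| ≤ τ / n := by
      rw [abs_of_nonneg (div_nonneg t.2.1 n.cast_nonneg)]
      exact div_le_div_of_nonneg_right t.2.2 n.cast_nonneg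
    have hle := ENNReal.rpow_le_rpow (spNorm_fracDiff_le_modulus (p := p) (α := α) f ht) hp.le
    simpa only [spNorm_fracDiff_rpow hp hα _ hf hY, mul_div_left_comm, D, div_mul_eq_mul_div,
      mul_div_assoc] using hle
  calc ENNReal.ofReal r * bestApprox p n f ^ p
      = ∑' k, ENNReal.ofReal r *
          if n ≤ l1 k then ENNReal.ofReal (‖coeff f k‖ ^ p) else 0 := by
        rw [bestApprox_rpow hp hn hf, ENNReal.tsum_mul_left]
    _ ≤ ∑' k, ∫⁻ t, ENNReal.ofReal (D k t) * ENNReal.ofReal (‖coeff f k‖ ^ p) ∂m := by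
        refine ENNReal.tsum_le_tsum fun k => ?_
        rw [lintegral_mul_const _ (hD k).measurable.ennreal_ofReal]
        split_ifs with hk
        · exact mul_le_mul_left (hcoeff k hk) _
        · simp only [mul_zero, zero_le]
    _ = ∫⁻ t, ∑' k, ENNReal.ofReal (D k t) * ENNReal.ofReal (‖coeff f k‖ ^ p) ∂m :=
        (lintegral_tsum fun k => ((hD k).measurable.ennreal_ofReal.mul_const _).aemeasurable).symm
    _ ≤ ∫⁻ _, modulus p α f (τ / n) ^ p ∂m := lintegral_mono hmod
    _ = modulus p α f (τ / n) ^ p := by rw [lintegral_const, measure_univ, mul_one]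

theorem bestApprox_le_constC_mul_modulus (hp : 0 < p) (hα : 0 < α) (hτ : 0 < τ) (hn : 1 ≤ n)
    {f : Torus d → ℂ} (hf : Integrable f) (hY : HasSpecY f) :
    bestApprox p n f ≤ constC n α p τ * modulus p α f (τ / n) := by
  have hγ : 0 ≤ α * p := by positivity
  have : Nonempty (Icc 0 τ) := (nonempty_Icc.2 hτ.le).to_subtype
  obtain ⟨m, _, hm⟩ := exists_isProbabilityMeasure_gameValue_le (payoff_nonneg (τ := τ) (n := n) hγ)
  have hV := ENNReal.ofReal_pos.2 (gameValue_payoff_pos hγ hτ hn)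
  rw [← ENNReal.rpow_le_rpow_iff hp, ENNReal.mul_rpow_of_nonneg _ _ hp.le, constC_eq hγ hτ, one_div,
    ENNReal.rpow_inv_rpow hp.ne', ← ENNReal.mul_le_iff_le_inv hV.ne' ENNReal.ofReal_ne_top]
  exact mul_bestApprox_rpow_le hp hα hn m hm hf hY

end Jackson

/-! ### Sharpness -/

section Sharpness

variable {α b p τ : ℝ} {n : ℕ} {ι : Type*} {κ : ι → Fin d → ℤ} {s : Finset ι} {w : ι → ℝ}

/-- The polynomial with frequencies `κ i` whose coefficients satisfy `|a_i|^p = w i`: the extremal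
function attached to the mixed strategy that plays `i` with probability `w i`. -/
def strategyPoly (p : ℝ) (κ : ι → Fin d → ℤ) (s : Finset ι) (w : ι → ℝ) : Torus d → ℂ :=
  ∑ i ∈ s, ((w i ^ (1 / p) : ℝ) : ℂ) • expo (κ i)

theorem integrable_strategyPoly (p : ℝ) (κ : ι → Fin d → ℤ) (s : Finset ι) (w : ι → ℝ) :
    Integrable (strategyPoly p κ s w) :=
  integrable_sum_smul_expo s _ κ

theorem coeff_strategyPoly_of_notMem_range {k : Fin d → ℤ} (hk : k ∉ range κ) :
    coeff (strategyPoly p κ s w) k = 0 := by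
  rw [strategyPoly, coeff_sum_smul_expo]
  exact Finset.sum_eq_zero fun i _ => if_neg fun hi => hk ⟨i, hi.symm⟩

theorem hasSpecY_strategyPoly (hY : ∀ i, κ i ∈ specY d) : HasSpecY (strategyPoly p κ s w) :=
  fun _ hk => coeff_strategyPoly_of_notMem_range fun ⟨i, hi⟩ => hk (hi ▸ hY i)

theorem tsum_mul_norm_coeff_strategyPoly (hp : 0 < p) (hκ : κ.Injective) (hw : ∀ i ∈ s, 0 ≤ w i)
    (F : (Fin d → ℤ) → ℝ≥0∞) :
    ∑' k, F k * ENNReal.ofReal (‖coeff (strategyPoly p κ s w) k‖ ^ p) =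
      ∑ i ∈ s, F (κ i) * ENNReal.ofReal (w i) := by
  have hcoeff (i : ι) (hi : i ∈ s) : ‖coeff (strategyPoly p κ s w) (κ i)‖ ^ p = w i := by
    have hroot : coeff (strategyPoly p κ s w) (κ i) = (w i ^ (1 / p) : ℝ) := by
      classical
      rw [strategyPoly, coeff_sum_smul_expo]
      simp [hκ.eq_iff, hi]
    rw [hroot, Complex.norm_real, Real.norm_of_nonneg (Real.rpow_nonneg (hw i hi) _), one_div,
      Real.rpow_inv_rpow (hw i hi) hp.ne']
  rw [tsum_eq_sum (s := s.map ⟨κ, hκ⟩), Finset.sum_map]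
  · exact Finset.sum_congr rfl fun i hi => by rw [Function.Embedding.coeFn_mk, hcoeff i hi]
  · intro k hk
    have hzero : coeff (strategyPoly p κ s w) k = 0 := by
      rw [strategyPoly, coeff_sum_smul_expo]
      refine Finset.sum_eq_zero fun i hi => if_neg ?_
      rintro rfl
      exact hk (Finset.mem_map_of_mem ⟨κ, hκ⟩ hi)
    rw [hzero, norm_zero, Real.zero_rpow hp.ne', ENNReal.ofReal_zero, mul_zero]

theorem spNorm_strategyPoly (hp : 0 < p) (hκ : κ.Injective) (hw : ∀ i ∈ s, 0 ≤ w i)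
    (hw1 : ∑ i ∈ s, w i = 1) : spNorm p (strategyPoly p κ s w) = 1 := by
  have hsum := tsum_mul_norm_coeff_strategyPoly hp hκ hw 1
  simp only [Pi.one_apply, one_mul] at hsum
  rw [spNorm, hsum, ← ENNReal.ofReal_sum_of_nonneg hw, hw1, ENNReal.ofReal_one, ENNReal.one_rpow]

theorem bestApprox_strategyPoly (hp : 0 < p) (hn : 1 ≤ n) (hκ : κ.Injective)
    (hκn : ∀ i, n ≤ l1 (κ i)) (hw : ∀ i ∈ s, 0 ≤ w i) (hw1 : ∑ i ∈ s, w i = 1) :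
    bestApprox p n (strategyPoly p κ s w) = 1 := by
  rw [bestApprox_eq_spNorm hp hn (integrable_strategyPoly p κ s w) fun k hk =>
    coeff_strategyPoly_of_notMem_range fun ⟨i, hi⟩ => (hi ▸ hκn i).not_gt hk]
  exact spNorm_strategyPoly hp hκ hw hw1

theorem modulus_strategyPoly_le (hp : 0 < p) (hα : 0 < α) (hκ : κ.Injective)
    (hY : ∀ i, κ i ∈ specY d) (hw : ∀ i ∈ s, 0 ≤ w i)
    (hb : ∀ h ∈ Icc 0 τ, ∑ i ∈ s, w i * diffSymbol (α * p) (l1 (κ i) * h) ≤ b) :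
    modulus p α (strategyPoly p κ s w) τ ≤ ENNReal.ofReal b ^ (1 / p) := by
  refine iSup₂_le fun h hh => ?_
  rw [one_div, ENNReal.le_rpow_inv_iff hp, spNorm_fracDiff_rpow hp hα h
    (integrable_strategyPoly p κ s w) (hasSpecY_strategyPoly hY),
    tsum_mul_norm_coeff_strategyPoly hp hκ hw fun k =>
      ENNReal.ofReal (diffSymbol (α * p) (l1 k * h))]
  have habs (k : Fin d → ℤ) :
      diffSymbol (α * p) (l1 k * h) = diffSymbol (α * p) (l1 k * |h|) := by
    rw [← diffSymbol_abs, abs_mul, Nat.abs_cast]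
  simp_rw [habs, ← ENNReal.ofReal_mul (diffSymbol_nonneg _ _)]
  rw [← ENNReal.ofReal_sum_of_nonneg fun i hi => mul_nonneg (diffSymbol_nonneg _ _) (hw i hi)]
  simp_rw [mul_comm _ (w _)]
  exact ENNReal.ofReal_le_ofReal (hb |h| ⟨abs_nonneg h, hh⟩)

theorem inv_rpow_le_constK (hp : 0 < p) (hα : 0 < α) (hn : 1 ≤ n) (hκ : κ.Injective)
    (hY : ∀ i, κ i ∈ specY d) (hκn : ∀ i, n ≤ l1 (κ i)) (hw : ∀ i ∈ s, 0 ≤ w i)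
    (hw1 : ∑ i ∈ s, w i = 1)
    (hb : ∀ h ∈ Icc 0 (τ / n), ∑ i ∈ s, w i * diffSymbol (α * p) (l1 (κ i) * h) ≤ b) :
    (ENNReal.ofReal b)⁻¹ ^ (1 / p) ≤ constK d n α p τ := by
  set f := strategyPoly p κ s w
  have hE : bestApprox p n f = 1 := bestApprox_strategyPoly hp hn hκ hκn hw hw1
  have hmem : MemSp p f := ⟨integrable_strategyPoly p κ s w, by
    rw [spNorm_strategyPoly hp hκ hw hw1]
    exact ENNReal.one_lt_top⟩
  have hconst : ¬ ∃ c : ℂ, f =ᵐ[volume] fun _ => c := fun ⟨c, hc⟩ =>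
    one_ne_zero (hE.symm.trans (bestApprox_eq_zero_of_ae_eq_const hp n hc))
  calc (ENNReal.ofReal b)⁻¹ ^ (1 / p) = bestApprox p n f / ENNReal.ofReal b ^ (1 / p) := by
        rw [hE, ENNReal.inv_rpow, ← one_div]
    _ ≤ bestApprox p n f / modulus p α f (τ / n) := by
        gcongr
        exact modulus_strategyPoly_le hp hα hκ hY hw hb
    _ ≤ constK d n α p τ :=
        le_iSup₂_of_le f ⟨hmem, hasSpecY_strategyPoly hY, hconst⟩ le_rfl

theorem l1_single (j : Fin d) (a : ℤ) : l1 (Pi.single j a) = a.natAbs := by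
  simp [l1, Pi.single_apply, apply_ite Int.natAbs]

theorem single_mem_specY (j : Fin d) {a : ℤ} (ha : 0 ≤ a) : Pi.single j a ∈ specY d :=
  Or.inl (Pi.single_nonneg.2 ha : (0 : Fin d → ℤ) ≤ Pi.single j a)

theorem constC_le_constK (hd : 1 ≤ d) (hp : 0 < p) (hα : 0 < α) (hτ : 0 < τ) (hn : 1 ≤ n) :
    constC n α p τ ≤ constK d n α p τ := by
  have hγ : 0 ≤ α * p := by positivity
  have hn0 : (0 : ℝ) < n := by exact_mod_cast hn
  let κ : {ν : ℕ // n ≤ ν} → Fin d → ℤ := fun ν => Pi.single ⟨0, hd⟩ (ν : ℤ)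
  have hκ : κ.Injective :=
    (Pi.single_injective _).comp (Nat.cast_injective.comp Subtype.val_injective)
  have hl1 (ν : {ν : ℕ // n ≤ ν}) : l1 (κ ν) = ν := by rw [l1_single, Int.natAbs_natCast]
  have hlt (b : ℝ) (hb : gameValue (payoff hγ n τ) < b) :
      (ENNReal.ofReal b)⁻¹ ^ (1 / p) ≤ constK d n α p τ := by
    obtain ⟨s, w, hw, hw1, hle⟩ := exists_sum_mul_le_of_gameValue_lt hb
    refine inv_rpow_le_constK hp hα hn hκ (fun ν => single_mem_specY _ (Nat.cast_nonneg _))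
      (fun ν => (hl1 ν).symm ▸ ν.2) hw hw1 fun h hh => ?_
    have hnh : n * h ∈ Icc 0 τ := ⟨mul_nonneg hn0.le hh.1, (le_div_iff₀' hn0).1 hh.2⟩
    refine (Finset.sum_congr rfl fun ν _ => ?_).trans_le (hle ⟨n * h, hnh⟩)
    change _ = w ν * diffSymbol _ _
    rw [hl1, ← mul_assoc, div_mul_cancel₀ _ hn0.ne']
  have hcont : Continuous fun b : ℝ => (ENNReal.ofReal b)⁻¹ ^ (1 / p) :=
    ENNReal.continuous_rpow_const.comp (continuous_inv.comp ENNReal.continuous_ofReal)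
  rw [constC_eq hγ hτ]
  exact le_of_tendsto (hcont.continuousWithinAt (s := Ioi (gameValue (payoff hγ n τ))))
    (eventually_nhdsWithin_of_forall hlt)

theorem constK_le_constC (hp : 0 < p) (hα : 0 < α) (hτ : 0 < τ) (hn : 1 ≤ n) :
    constK d n α p τ ≤ constC n α p τ :=
  iSup₂_le fun _ hf => ENNReal.div_le_of_le_mul
    (bestApprox_le_constC_mul_modulus hp hα hτ hn hf.1.1 hf.2.1)

end Sharpness

end JacksonSp

end

open JacksonSp in
theorem theorem3p1_general {d : ℕ} (hd : 1 ≤ d) {p : ℝ} (hp : 0 < p) {τ : ℝ} (hτ : 0 < τ)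
    {n : ℕ} (hn : 1 ≤ n) {α : ℝ} (hα : 0 < α) :
    (∀ f : Torus d → ℂ, Integrable f → HasSpecY f →
      bestApprox p n f ≤ constC n α p τ * modulus p α f (τ / n)) ∧
    constC n α p τ ≠ ∞ ∧
    (∃ μ ∈ admissible τ, ratio n α p τ μ = ⨅ μ' ∈ admissible τ, ratio n α p τ μ') ∧
    constC n α p τ = constK d n α p τ := by
  have hγ : 0 ≤ α * p := by positivity
  obtain ⟨μ, hμ, hratio⟩ := exists_mem_admissible_ratio_eq (n := n) hγ hτ
  exact ⟨fun f hf hY => bestApprox_le_constC_mul_modulus hp hα hτ hn hf hY,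
    constC_ne_top hp hα hτ hn,
    ⟨μ, hμ, hratio.trans (iInf_ratio_eq hγ hτ).symm⟩,
    (constC_le_constK hd hp hα hτ hn).antisymm (constK_le_constC hp hα hτ hn)⟩

theorem theorem3p1 (d : ℕ) (hd : 1 ≤ d) (p : ℝ) (hp : 1 ≤ p) (τ : ℝ) (hτ : 0 < τ)
    (n : ℕ) (hn : 1 ≤ n) (α : ℝ) (hα : 0 < α) :
    (∀ f : JacksonSp.Torus d → ℂ, JacksonSp.MemSp p f → JacksonSp.HasSpecY f →
      JacksonSp.bestApprox p n f ≤
        JacksonSp.constC n α p τ * JacksonSp.modulus p α f (τ / n)) ∧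
    JacksonSp.constC n α p τ ≠ ∞ ∧
    (∃ μ ∈ JacksonSp.admissible τ, JacksonSp.ratio n α p τ μ =
      ⨅ μ' ∈ JacksonSp.admissible τ, JacksonSp.ratio n α p τ μ') ∧
    JacksonSp.constC n α p τ = JacksonSp.constK d n α p τ := by
  have h := theorem3p1_general hd (one_pos.trans_le hp) hτ hn hα
  exact ⟨fun f hf => h.1 f hf.1, h.2⟩
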